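/- All groups are finite. For a prime $p$, let $\mathscr{U}$ be the class of supersolvable groups and $\mathscr{U}_p$ the class of $p$-supersolvable groups (those in which every chief factor is a $p'$-group or has order $p$). For a class $\mathscr{F}\in\{\mathscr{U},\mathscr{U}_p\}$ and a group $T$, let $T^{\mathscr{F}}$ be the intersection of all normal subgroups $N$ of $T$ with $T/N\in\mathscr{F}$. For a subgroup $H$ of $G$ put $$N_{\mathscr{F}}(G,H)=\bigcap_{T\le H}N_G(T^{\mathscr{F}}).$$ Let $\pi(H)$ be the set of prime divisors of $|H|$. **Theorem.** Let $G$ be a finite solvable group and $H$ a normal subgroup of $G$. Then $$\bigcap_{p\in\pi(H)}N_{\mathscr{U}_p}(G,H)=1\quad\text{if and only if}\quad N_{\mathscr{U}}(G,H)=1,$$ where for $H=1$ the intersection over the empty set $\pi(H)$ is understood to be $G$. -/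

import Mathlib

universe u

/-- A class of groups (in a fixed universe). -/
abbrev GroupClass := ∀ (X : Type u) [Group X], Prop

/-- `L / K` is a chief factor of `G`: `K < L` are normal subgroups of `G`, and no normal subgroup
of `G` lies strictly between them. -/
def IsChiefFactor {G : Type u} [Group G] (K L : Subgroup G) : Prop :=
  K.Normal ∧ L.Normal ∧ K < L ∧ ∀ M : Subgroup G, M.Normal → K ≤ M → M ≤ L → M = K ∨ M = L

/-- A (finite) group is `p`-supersolvable if every chief factor of it is a `p'`-group or has
order `p`. Note that `K.relIndex L` is the order of `L / K` when `K ≤ L`. -/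
def IsPSupersolvable (p : ℕ) (G : Type u) [Group G] : Prop :=
  ∀ K L : Subgroup G, IsChiefFactor K L → ¬ p ∣ K.relIndex L ∨ K.relIndex L = p

/-- A group is supersolvable if it has a finite series `1 = C 0 ≤ C 1 ≤ ⋯ ≤ C n = G` of normal
subgroups of `G` all of whose factors `C (i + 1) / C i` (written as the image of `C (i + 1)` in
`G / C i`) are cyclic. -/
def IsSupersolvable (G : Type u) [Group G] : Prop :=
  ∃ (n : ℕ) (C : ℕ → Subgroup G) (_ : ∀ i, (C i).Normal),
    C 0 = ⊥ ∧ C n = ⊤ ∧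
      ∀ i < n, C i ≤ C (i + 1) ∧ IsCyclic ((C (i + 1)).map (QuotientGroup.mk' (C i)))

/-- The class of supersolvable groups. -/
def supersolvableClass : GroupClass.{u} := fun X _ => IsSupersolvable X

/-- The class of `p`-supersolvable groups. -/
def pSupersolvableClass (p : ℕ) : GroupClass.{u} := fun X _ => IsPSupersolvable p X

/-- The residual of `G` with respect to the class `F`: the intersection of all normal subgroups
`N` of `G` with `G / N` in `F`. -/
def groupResidual (F : GroupClass.{u}) (G : Type u) [Group G] : Subgroup G :=
  sInf {N : Subgroup G | ∃ _ : N.Normal, F (G ⧸ N)}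

/-- The residual of a subgroup `T` of `G` (formed in the group `T`), as a subgroup of `G`. -/
def subgroupResidual (F : GroupClass.{u}) {G : Type u} [Group G] (T : Subgroup G) : Subgroup G :=
  (groupResidual F T).map T.subtype

/-- The weak norm of `H` in `G` with respect to `F`: the intersection, over all subgroups `T` of
`H`, of the normalizers in `G` of the residuals of `T`. -/
def weakNorm (F : GroupClass.{u}) {G : Type u} [Group G] (H : Subgroup G) : Subgroup G :=
  ⨅ T : Subgroup G, ⨅ _ : T ≤ H, Subgroup.normalizer (subgroupResidual F T : Set G)

/-! For every subgroup H of a finite solvable group the two sides are equal as subgroups, not merely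
trivial together (`iInf_weakNorm_eq`). Write U(T) and U_p(T) for the residuals of T ≤ H.

A solvable group is supersolvable once it is p-supersolvable for every p, so U(T) is the join of the
U_p(T) over the primes p dividing |H| (`groupResidual_supersolvableClass_eq_iSup`). Whatever
normalizes each U_p(T) normalizes U(T).

Conversely, let g normalize U(S) for all S ≤ H; induction on T shows that g normalizes U_p(T). Let K
be the join of the U_p(S) with S < T, which g normalizes by induction. A Frattini argument
(`groupResidual_le_or_isPGroup`) gives U_p(T) = K or makes U_p(T) a p-group. In the second case,
since solvable p-supersolvable groups are p'-by-supersolvable, U(T)/U_p(T) is a p'-group. Hence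
U_p(T) is the set of p-elements of U(T) (`mem_groupResidual_iff_of_isPGroup`), and g preserves it.
-/

namespace Subgroup

variable {G : Type*} [Group G]

/-- Dedekind's modular law, for a normal subgroup `N`. -/
theorem sup_inf_le_of_le_of_normal {A B N : Subgroup G} [N.Normal] (h : A ≤ B) :
    (A ⊔ N) ⊓ B ≤ A ⊔ (N ⊓ B) := by
  rintro x ⟨hx, hxB⟩
  obtain ⟨a, ha, n, hn, rfl⟩ := mem_sup_of_normal_right.1 hx
  exact mul_mem_sup ha ⟨hn, (B.mul_mem_cancel_left (h ha)).1 hxB⟩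

end Subgroup

open Subgroup

/-! ### Chief factors relative to a normal subgroup and under pullback -/

section ChiefFactor

variable {T : Type u} [Group T] {K L N : Subgroup T}

/-- With `inf_of_eq` this replaces Jordan–Hölder: joining with N or meeting with N carries a chief
factor to one of the same order, above N or inside N. -/
theorem IsChiefFactor.sup_of_ne (h : IsChiefFactor K L) (hN : N.Normal)
    (hne : K ⊔ N ≠ L ⊔ N) :
    IsChiefFactor (K ⊔ N) (L ⊔ N) ∧ (K ⊔ N).relIndex (L ⊔ N) = K.relIndex L := by
  obtain ⟨hK, hL, hlt, hmax⟩ := h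
  have hle : K ⊔ N ≤ L ⊔ N := sup_le_sup_right hlt.le N
  have hinf : (K ⊔ N) ⊓ L = K := by
    refine (hmax _ inferInstance (le_inf le_sup_left hlt.le) inf_le_right).resolve_right fun h ↦ ?_
    exact hne (le_antisymm hle (sup_le (inf_eq_right.1 h) le_sup_right))
  refine ⟨⟨inferInstance, inferInstance, lt_of_le_of_ne hle hne, fun M hM h1 h2 ↦ ?_⟩, ?_⟩
  · have hNM : N ≤ M := le_sup_right.trans h1
    have hM' : M ≤ N ⊔ (L ⊓ M) := by
      refine le_trans ?_ (sup_inf_le_of_le_of_normal hNM)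
      rw [sup_comm N L]
      exact le_inf h2 le_rfl
    rcases hmax (L ⊓ M) inferInstance (le_inf hlt.le (le_sup_left.trans h1)) inf_le_left with e | e
    · left
      rw [e, sup_comm] at hM'
      exact le_antisymm hM' h1
    · right
      exact le_antisymm h2 (sup_le (inf_eq_left.1 e) hNM)
  · have h1 : L ⊔ N = L ⊔ (K ⊔ N) := by
      rw [← sup_assoc, sup_of_le_left hlt.le]
    rw [h1, relIndex_sup_right, ← inf_relIndex_right, hinf]

theorem IsChiefFactor.inf_of_eq (h : IsChiefFactor K L) (hN : N.Normal)
    (heq : K ⊔ N = L ⊔ N) :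
    IsChiefFactor (K ⊓ N) (L ⊓ N) ∧ (K ⊓ N).relIndex (L ⊓ N) = K.relIndex L := by
  obtain ⟨hK, hL, hlt, hmax⟩ := h
  have hle : K ⊓ N ≤ L ⊓ N := inf_le_inf_right N hlt.le
  have hsup : K ⊔ (L ⊓ N) = L := by
    refine le_antisymm (sup_le hlt.le inf_le_left) ?_
    rw [inf_comm]
    refine le_trans (le_inf ?_ le_rfl) (sup_inf_le_of_le_of_normal hlt.le)
    rw [heq]
    exact le_sup_left
  refine ⟨⟨inferInstance, inferInstance, lt_of_le_of_ne hle fun e ↦ ?_, fun M hM h1 h2 ↦ ?_⟩, ?_⟩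
  · rw [← e, sup_of_le_left inf_le_left] at hsup
    exact hlt.ne hsup
  · have hMN : M ≤ N := h2.trans inf_le_right
    have key : (M ⊔ K) ⊓ N ≤ M := (sup_inf_le_of_le_of_normal hMN).trans (sup_le le_rfl h1)
    rcases hmax (M ⊔ K) inferInstance le_sup_right (sup_le (h2.trans inf_le_left) hlt.le)
      with e | e <;> rw [e] at key
    · exact Or.inl (le_antisymm (le_inf (le_sup_left.trans e.le) hMN) key)
    · exact Or.inr (le_antisymm h2 key)
  · conv_rhs => rw [← hsup, sup_comm, relIndex_sup_right]
    rw [← inf_relIndex_right K, ← inf_assoc, inf_of_le_left hlt.le]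

theorem exists_isChiefFactor [Finite T] (hK : K.Normal) (hL : L.Normal) (h : K < L) :
    ∃ M ≤ L, IsChiefFactor K M := by
  obtain ⟨M, hML, hM⟩ := (Set.toFinite {M : Subgroup T | M.Normal ∧ K < M}).exists_le_minimal ⟨hL, h⟩
  refine ⟨M, hML, hK, hM.1.1, hM.1.2, fun J hJ h1 h2 ↦ ?_⟩
  rcases h1.eq_or_lt with e | e
  · exact Or.inl e.symm
  · exact Or.inr (hM.eq_of_le ⟨hJ, e⟩ h2)

theorem IsChiefFactor.comap {T' : Type u} [Group T'] {f : T →* T'} (hf : Function.Surjective f)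
    {K L : Subgroup T'} (h : IsChiefFactor K L) : IsChiefFactor (K.comap f) (L.comap f) := by
  obtain ⟨hK, hL, hlt, hmax⟩ := h
  refine ⟨inferInstance, inferInstance, (comap_lt_comap_of_surjective hf).2 hlt, fun M hM h1 h2 ↦ ?_⟩
  have hker : f.ker ≤ M := le_trans (by rw [← MonoidHom.comap_bot]; exact comap_mono bot_le) h1
  have hM' : (M.map f).comap f = M := comap_map_eq_self hker
  have hKM : K ≤ M.map f := by
    rw [← map_comap_eq_self_of_surjective hf K]
    exact map_mono h1
  rcases hmax (M.map f) (hM.map f hf) hKM (map_le_iff_le_comap.2 h2) with e | e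
  · left; rw [← hM', e]
  · right; rw [← hM', e]

theorem relIndex_comap_comap_of_surjective {T' : Type u} [Group T'] {f : T →* T'}
    (hf : Function.Surjective f) (K L : Subgroup T') :
    (K.comap f).relIndex (L.comap f) = K.relIndex L := by
  rw [relIndex_comap, map_comap_eq_self_of_surjective hf]

end ChiefFactor

/-! ### p-supersolvable quotients, expressed inside the group -/

/-- Every chief factor of the group above `N` is a `p'`-group or has order `p`; for normal `N` this
says that the quotient by `N` is `p`-supersolvable. -/
def PSupersolvableOver {T : Type u} [Group T] (p : ℕ) (N : Subgroup T) : Prop :=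
  ∀ K L : Subgroup T, IsChiefFactor K L → N ≤ K → ¬ p ∣ K.relIndex L ∨ K.relIndex L = p

namespace PSupersolvableOver

variable {T : Type u} [Group T] {p : ℕ} {M N : Subgroup T}

theorem mono (h : PSupersolvableOver p N) (hNM : N ≤ M) : PSupersolvableOver p M :=
  fun K L hKL hM ↦ h K L hKL (hNM.trans hM)

theorem of_isPSupersolvable (h : IsPSupersolvable p T) : PSupersolvableOver p N :=
  fun K L hKL _ ↦ h K L hKL

theorem isPSupersolvable (h : PSupersolvableOver p (⊥ : Subgroup T)) : IsPSupersolvable p T :=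
  fun K L hKL ↦ h K L hKL bot_le

theorem top : PSupersolvableOver p (⊤ : Subgroup T) :=
  fun _ _ hKL h ↦ absurd (h.trans_lt hKL.2.2.1) not_top_lt

theorem trans (hM : M.Normal) (h : PSupersolvableOver p M) (hNM : N ≤ M)
    (h' : ∀ K L : Subgroup T, IsChiefFactor K L → N ≤ K → L ≤ M →
      ¬ p ∣ K.relIndex L ∨ K.relIndex L = p) : PSupersolvableOver p N := by
  intro K L hKL hK
  by_cases e : K ⊔ M = L ⊔ M
  · obtain ⟨h1, h2⟩ := hKL.inf_of_eq hM e
    rw [← h2]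
    exact h' _ _ h1 (le_inf hK hNM) inf_le_right
  · obtain ⟨h1, h2⟩ := hKL.sup_of_ne hM e
    rw [← h2]
    exact h _ _ h1 le_sup_right

/-- Below M, a chief factor L/K above M ⊓ N survives joining with N: otherwise Dedekind's law gives
L ≤ K(N ⊓ L) ≤ K. -/
theorem inf (hM : M.Normal) (hN : N.Normal) (h1 : PSupersolvableOver p M)
    (h2 : PSupersolvableOver p N) : PSupersolvableOver p (M ⊓ N) := by
  refine h1.trans hM inf_le_left fun K L hKL hK hL ↦ ?_
  have hne : K ⊔ N ≠ L ⊔ N := by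
    intro e
    have : L ≤ K := by
      refine le_trans (le_inf ?_ le_rfl) ((sup_inf_le_of_le_of_normal (N := N) hKL.2.2.1.le).trans
        (sup_le le_rfl ?_))
      · rw [e]; exact le_sup_left
      · exact le_trans (le_inf (inf_le_right.trans hL) inf_le_left) hK
    exact absurd this hKL.2.2.1.not_ge
  obtain ⟨h3, h4⟩ := hKL.sup_of_ne hN hne
  rw [← h4]
  exact h2 _ _ h3 le_sup_right

theorem relIndex_dvd_of_between {K L : Subgroup T} (hNK : N ≤ K) (hKL : K ≤ L) (hLM : L ≤ M) :
    K.relIndex L ∣ N.relIndex M :=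
  (relIndex_dvd_of_le_left L hNK).trans
    ⟨L.relIndex M, (relIndex_mul_relIndex N L M (hNK.trans hKL) hLM).symm⟩

/-- The second alternative is divisibility, since pulling back a factor of order p along a
non-surjective map may make it trivial. -/
theorem trans_of_relIndex (hp : p.Prime) (hM : M.Normal) (h : PSupersolvableOver p M)
    (hNM : N ≤ M) (h' : ¬ p ∣ N.relIndex M ∨ N.relIndex M ∣ p) : PSupersolvableOver p N := by
  refine h.trans hM hNM fun K L hKL hK hL ↦ ?_
  have hd := relIndex_dvd_of_between hK hKL.2.2.1.le hL
  rcases h' with h' | h'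
  · exact Or.inl fun hc ↦ h' (hc.trans hd)
  · rcases (Nat.dvd_prime hp).1 (hd.trans h') with e | e
    · left; rw [e]; exact hp.one_lt.ne' ∘ Nat.dvd_one.1
    · exact Or.inr e

/-- Climb a chief series from N: each pulled-back factor embeds in the original one, so its order
divides the original order. -/
theorem comap {S : Type u} [Group S] [Finite T] (hp : p.Prime) (f : S →* T) :
    ∀ N : Subgroup T, N.Normal → PSupersolvableOver p N → PSupersolvableOver p (N.comap f) := by
  intro N
  induction N using WellFoundedGT.induction with
  | ind N ih =>
    intro hN h
    by_cases hT : N = ⊤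
    · subst hT; rw [comap_top]; exact top
    obtain ⟨M, -, hM⟩ := exists_isChiefFactor hN inferInstance (lt_top_iff_ne_top.2 hT)
    have hd : (N.comap f).relIndex (M.comap f) ∣ N.relIndex M := by
      have hle : (M.comap f).map f ⊔ N ≤ M := sup_le (map_comap_le f M) hM.2.2.1.le
      rw [relIndex_comap, ← relIndex_sup_right]
      exact relIndex_dvd_of_between le_rfl le_sup_right hle
    have hMn := hM.2.1
    refine trans_of_relIndex hp inferInstance (ih M hM.2.2.1 hM.2.1 (h.mono hM.2.2.1.le))
      (comap_mono hM.2.2.1.le) ?_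
    rcases h N M hM le_rfl with e | e
    · exact Or.inl fun hc ↦ e (hc.trans hd)
    · exact Or.inr (e ▸ hd)

theorem of_comap {S : Type u} [Group S] {f : S →* T} (hf : Function.Surjective f)
    (h : PSupersolvableOver p (N.comap f)) : PSupersolvableOver p N := by
  intro K L hKL hK
  rw [← relIndex_comap_comap_of_surjective hf]
  exact h _ _ (hKL.comap hf) (comap_mono hK)

theorem iff_quotient [Finite T] (hp : p.Prime) [N.Normal] :
    PSupersolvableOver p N ↔ IsPSupersolvable p (T ⧸ N) := by
  have e : (⊥ : Subgroup (T ⧸ N)).comap (QuotientGroup.mk' N) = N := by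
    rw [MonoidHom.comap_bot, QuotientGroup.ker_mk']
  constructor
  · intro h
    refine isPSupersolvable (of_comap (QuotientGroup.mk'_surjective N) ?_)
    rwa [e]
  · intro h
    have := comap hp (QuotientGroup.mk' N) ⊥ inferInstance (of_isPSupersolvable h)
    rwa [e] at this

/-- If `Y` supplements `N`, then the quotient by `N` is a quotient of `Y`. -/
theorem of_subgroup_sup_eq_top [Finite T] (hp : p.Prime) (hN : N.Normal) {Y : Subgroup T}
    (hY : Y ⊔ N = ⊤) (h : PSupersolvableOver p (N.subgroupOf Y)) : PSupersolvableOver p N := by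
  rw [iff_quotient hp]
  have e : (⊥ : Subgroup (T ⧸ N)).comap ((QuotientGroup.mk' N).comp Y.subtype) = N.subgroupOf Y := by
    rw [← comap_comap, MonoidHom.comap_bot, QuotientGroup.ker_mk']; rfl
  refine isPSupersolvable (of_comap (f := (QuotientGroup.mk' N).comp Y.subtype) ?_ (e ▸ h))
  intro q
  obtain ⟨x, rfl⟩ := QuotientGroup.mk'_surjective N q
  obtain ⟨y, hy, n, hn, rfl⟩ := mem_sup_of_normal_right.1 (hY ▸ mem_top x : x ∈ Y ⊔ N)
  refine ⟨⟨y, hy⟩, ?_⟩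
  simpa using hn

end PSupersolvableOver

/-! ### The p-supersolvable residual -/

section Residual

variable {T : Type u} [Group T] {p : ℕ}

theorem groupResidual_normal (F : GroupClass.{u}) : (groupResidual F T).Normal :=
  ⟨fun x hx g ↦ mem_sInf.2 fun N hN ↦ hN.1.conj_mem x (mem_sInf.1 hx N hN) g⟩

theorem groupResidual_le_of_psupersolvableOver [Finite T] (hp : p.Prime) {N : Subgroup T}
    (hN : N.Normal) (h : PSupersolvableOver p N) : groupResidual (pSupersolvableClass p) T ≤ N :=
  sInf_le ⟨hN, (PSupersolvableOver.iff_quotient hp).1 h⟩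

/-- Closure under intersections makes a minimal normal subgroup with p-supersolvable quotient the
least one. -/
theorem psupersolvableOver_groupResidual [Finite T] (hp : p.Prime) :
    PSupersolvableOver p (groupResidual (pSupersolvableClass p) T) := by
  obtain ⟨N, hN⟩ := (Set.toFinite {N : Subgroup T | N.Normal ∧ PSupersolvableOver p N}).exists_minimal
    ⟨⊤, inferInstance, PSupersolvableOver.top⟩
  have : groupResidual (pSupersolvableClass p) T = N := by
    refine le_antisymm (groupResidual_le_of_psupersolvableOver hp hN.1.1 hN.1.2)
      (le_sInf fun M ⟨hM, hM'⟩ ↦ ?_)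
    have hM'' := (PSupersolvableOver.iff_quotient hp).2 hM'
    have hNn := hN.1.1
    exact (hN.le_of_le ⟨inferInstance, hN.1.2.inf hN.1.1 hM hM''⟩ inf_le_left).trans inf_le_right
  rw [this]
  exact hN.1.2

/-- The `p`-supersolvable residual is compatible with homomorphisms, in particular with the
inclusion of a subgroup. -/
theorem map_groupResidual_le {S : Type u} [Group S] [Finite S] [Finite T] (hp : p.Prime)
    (f : S →* T) : (groupResidual (pSupersolvableClass p) S).map f ≤
      groupResidual (pSupersolvableClass p) T := by
  have := groupResidual_normal (T := T) (pSupersolvableClass p)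
  rw [map_le_iff_le_comap]
  exact groupResidual_le_of_psupersolvableOver hp inferInstance
    (PSupersolvableOver.comap hp f _ this (psupersolvableOver_groupResidual hp))

end Residual

/-! ### Cyclic factors, and chief factors of solvable groups -/

section CyclicFactor

variable {T : Type u} [Group T]

theorem Subgroup.isCyclic_of_le_zpowers {A : Subgroup T} {b : T} (h : A ≤ zpowers b) : IsCyclic A :=
  isCyclic_of_injective (inclusion h) (inclusion_injective h)

theorem Subgroup.isCyclic_map_mk'_iff {N M : Subgroup T} [N.Normal] :
    IsCyclic (M.map (QuotientGroup.mk' N)) ↔ ∃ b, M ≤ zpowers b ⊔ N := by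
  constructor
  · rintro ⟨⟨⟨_, b, hb, rfl⟩, hg⟩⟩
    refine ⟨b, fun x hx ↦ ?_⟩
    obtain ⟨k, hk⟩ := hg ⟨_, mem_map_of_mem (QuotientGroup.mk' N) hx⟩
    have hk' : QuotientGroup.mk' N (b ^ k) = QuotientGroup.mk' N x := by
      simpa using congrArg Subtype.val hk
    rw [QuotientGroup.mk'_eq_mk'] at hk'
    obtain ⟨z, hz, rfl⟩ := hk'
    exact mul_mem_sup (zpow_mem (mem_zpowers b) k) hz
  · rintro ⟨b, hb⟩
    refine isCyclic_of_le_zpowers (b := QuotientGroup.mk' N b) ?_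
    refine (map_mono hb).trans ?_
    rw [map_sup, MonoidHom.map_zpowers, QuotientGroup.map_mk'_self, sup_bot_eq]

/-- Conjugation acts on a cyclic normal subgroup as a power map. -/
theorem Subgroup.normal_of_le_isCyclic {M J : Subgroup T} (hM : M.Normal) [IsCyclic M] (h : J ≤ M) :
    J.Normal := by
  refine ⟨fun x hx g ↦ ?_⟩
  obtain ⟨m, hm⟩ := (MulAut.conjNormal g : MulAut M).toMonoidHom.map_cyclic
  have := congrArg Subtype.val (hm ⟨x, h hx⟩)
  have e : g * x * g⁻¹ = x ^ m := by simpa using this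
  rw [e]
  exact zpow_mem hx m

end CyclicFactor

section ChiefFactor

variable {T : Type u} [Group T] {K L : Subgroup T}

theorem IsChiefFactor.map_mk' (h : IsChiefFactor K L) [K.Normal] :
    IsChiefFactor ⊥ (L.map (QuotientGroup.mk' K)) := by
  obtain ⟨hK, hL, hlt, hmax⟩ := h
  have hs := QuotientGroup.mk'_surjective K
  refine ⟨inferInstance, hL.map _ hs, bot_lt_iff_ne_bot.2 fun e ↦ ?_, fun M hM _ h2 ↦ ?_⟩
  · rw [Subgroup.map_eq_bot_iff, QuotientGroup.ker_mk'] at e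
    exact hlt.not_ge e
  · have hKM : K ≤ M.comap (QuotientGroup.mk' K) := by
      conv_lhs => rw [← QuotientGroup.ker_mk' K, ← MonoidHom.comap_bot]
      exact comap_mono bot_le
    have hML : M.comap (QuotientGroup.mk' K) ≤ L := by
      refine (comap_mono h2).trans ?_
      rw [QuotientGroup.comap_map_mk', sup_of_le_right hlt.le]
    rcases hmax _ inferInstance hKM hML with e | e
    · left
      rw [← map_comap_eq_self_of_surjective hs M, e, QuotientGroup.map_mk'_self]
    · right
      rw [← map_comap_eq_self_of_surjective hs M, e]

theorem Subgroup.card_map_mk' [K.Normal] : Nat.card (L.map (QuotientGroup.mk' K)) = K.relIndex L := by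
  rw [← relIndex_ker, QuotientGroup.ker_mk']

/-- A cyclic minimal normal subgroup has prime order. -/
theorem IsChiefFactor.prime_of_isCyclic [Finite T] (h : IsChiefFactor ⊥ L) [IsCyclic L] :
    (Nat.card L).Prime := by
  obtain ⟨-, hL, hlt, hmax⟩ := h
  have hne : Nat.card L ≠ 1 := fun e ↦ hlt.ne' (L.card_eq_one.1 e)
  obtain ⟨q, hq, hqd⟩ := Nat.exists_prime_and_dvd hne
  have := Fact.mk hq
  obtain ⟨z, hz⟩ := exists_prime_orderOf_dvd_card' q hqd
  have hle : zpowers (z : T) ≤ L := zpowers_le.2 z.2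
  have hz' : orderOf (z : T) = q := by rw [orderOf_coe, hz]
  rcases hmax _ (normal_of_le_isCyclic hL hle) bot_le hle with e | e
  · rw [zpowers_eq_bot] at e
    rw [e, orderOf_one] at hz'
    exact absurd hz' hq.one_lt.ne
  · rwa [← e, Nat.card_zpowers, hz']

/-- By minimality L is abelian; its q-elements then form a normal subgroup, nontrivial by Cauchy for
q dividing |L|. -/
theorem IsChiefFactor.isPGroup_of_isSolvable [Finite T] [Group.IsSolvable T]
    (h : IsChiefFactor ⊥ L) : ∃ q, q.Prime ∧ IsPGroup q L := by
  obtain ⟨-, hL, hlt, hmax⟩ := h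
  have hcomm : ⁅L, L⁆ = ⊥ :=
    (hmax ⁅L, L⁆ inferInstance bot_le (commutator_le_left L L)).resolve_right
      (Group.IsSolvable.commutator_lt_of_ne_bot hlt.ne').ne
  have hcomm' : ∀ x ∈ L, ∀ y ∈ L, x * y = y * x := fun x hx y hy ↦
    (Subgroup.mem_centralizer_iff.1 (commutator_eq_bot_iff_le_centralizer.1 hcomm hx) y hy).symm
  have hne : Nat.card L ≠ 1 := fun e ↦ hlt.ne' (L.card_eq_one.1 e)
  obtain ⟨q, hq, hqd⟩ := Nat.exists_prime_and_dvd hne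
  have := Fact.mk hq
  let J : Subgroup T :=
    { carrier := {x | x ∈ L ∧ ∃ k, x ^ q ^ k = 1}
      one_mem' := ⟨L.one_mem, 0, one_pow _⟩
      mul_mem' := by
        rintro x y ⟨hx, k, hk⟩ ⟨hy, l, hl⟩
        refine ⟨L.mul_mem hx hy, k + l, ?_⟩
        rw [(show Commute x y from hcomm' x hx y hy).mul_pow, pow_add, pow_mul, hk, one_pow, mul_comm,
          pow_mul, hl, one_pow, one_mul]
      inv_mem' := by
        rintro x ⟨hx, k, hk⟩
        exact ⟨L.inv_mem hx, k, by rw [inv_pow, hk, inv_one]⟩ }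
  have hJ : J.Normal := ⟨by
    rintro x ⟨hx, k, hk⟩ g
    exact ⟨hL.conj_mem x hx g, k, by rw [conj_pow, hk, mul_one, mul_inv_cancel]⟩⟩
  obtain ⟨z, hz⟩ := exists_prime_orderOf_dvd_card' q hqd
  rcases hmax J hJ bot_le (fun x hx ↦ hx.1) with e | e
  · have : (z : T) ∈ J := ⟨z.2, 1, by rw [pow_one, ← hz, ← orderOf_coe, pow_orderOf_eq_one]⟩
    rw [e, mem_bot, OneMemClass.coe_eq_one] at this
    rw [this, orderOf_one] at hz
    exact absurd hz hq.one_lt.ne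
  · refine ⟨q, hq, fun ⟨x, hx⟩ ↦ ?_⟩
    rw [← e] at hx
    obtain ⟨hx, k, hk⟩ := hx
    exact ⟨k, Subtype.ext hk⟩

theorem IsChiefFactor.relIndex_eq_prime_pow [Finite T] [Group.IsSolvable T]
    (h : IsChiefFactor K L) : ∃ q k, q.Prime ∧ k ≠ 0 ∧ K.relIndex L = q ^ k := by
  have hK := h.1
  obtain ⟨q, hq, hL⟩ := h.map_mk'.isPGroup_of_isSolvable
  have := Fact.mk hq
  obtain ⟨k, hk⟩ := IsPGroup.iff_card.1 hL
  rw [card_map_mk'] at hk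
  refine ⟨q, k, hq, ?_, hk⟩
  rintro rfl
  rw [pow_zero, relIndex_eq_one] at hk
  exact h.2.2.1.not_ge hk

end ChiefFactor

/-! ### Supersolvable quotients and the supersolvable residual -/

/-- There is a series of normal subgroups from `N` to the whole group with cyclic factors; for
normal `N` this says that the quotient by `N` is supersolvable. -/
inductive SupersolvableOver {T : Type u} [Group T] : Subgroup T → Prop
  | top : SupersolvableOver ⊤
  | step (N M : Subgroup T) (b : T) : N.Normal → N ≤ M → M ≤ zpowers b ⊔ N →
      SupersolvableOver M → SupersolvableOver N

namespace SupersolvableOver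

variable {T : Type u} [Group T] {N : Subgroup T}

theorem normal (h : SupersolvableOver N) : N.Normal := by
  cases h <;> first | assumption | infer_instance

theorem of_isSupersolvable (h : IsSupersolvable T) : SupersolvableOver (⊥ : Subgroup T) := by
  obtain ⟨n, C, hC, h0, hn, hs⟩ := h
  have key : ∀ j ≤ n, SupersolvableOver (C (n - j)) := by
    intro j
    induction j with
    | zero => intro _; rw [Nat.sub_zero, hn]; exact top
    | succ j ih =>
      intro hj
      obtain ⟨h1, h2⟩ := hs (n - (j + 1)) (by omega)
      obtain ⟨b, hb⟩ := isCyclic_map_mk'_iff.1 h2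
      rw [show n - (j + 1) + 1 = n - j by omega] at h1 hb
      exact step _ _ b (hC _) h1 hb (ih (by omega))
  have := key n le_rfl
  rwa [Nat.sub_self, h0] at this

theorem exists_series (h : SupersolvableOver N) :
    ∃ (n : ℕ) (C : ℕ → Subgroup T) (_ : ∀ i, (C i).Normal), C 0 = N ∧ C n = ⊤ ∧
      ∀ i < n, C i ≤ C (i + 1) ∧ IsCyclic ((C (i + 1)).map (QuotientGroup.mk' (C i))) := by
  induction h with
  | top => exact ⟨0, fun _ ↦ ⊤, fun _ ↦ inferInstance, rfl, rfl, fun i hi ↦ absurd hi (Nat.not_lt_zero i)⟩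
  | step N M b hN hNM hM _ ih =>
    obtain ⟨n, C, hC, h0, hn, hs⟩ := ih
    let D : ℕ → Subgroup T := fun i ↦ Nat.casesOn i N C
    have hD : ∀ i, (D i).Normal := fun i ↦ by cases i; exacts [hN, hC _]
    refine ⟨n + 1, D, hD, rfl, hn, fun i hi ↦ ?_⟩
    cases i with
    | zero =>
      change N ≤ C 0 ∧ IsCyclic ((C 0).map (QuotientGroup.mk' N))
      rw [h0]
      exact ⟨hNM, isCyclic_map_mk'_iff.2 ⟨b, hM⟩⟩
    | succ i => exact hs i (by omega)

theorem isSupersolvable (h : SupersolvableOver (⊥ : Subgroup T)) : IsSupersolvable T :=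
  h.exists_series

theorem map {T' : Type u} [Group T'] {f : T →* T'} (hf : Function.Surjective f)
    (h : SupersolvableOver N) : SupersolvableOver (N.map f) := by
  induction h with
  | top => rw [map_top_of_surjective f hf]; exact top
  | step N M b hN hNM hM _ ih =>
    refine step _ _ (f b) (hN.map f hf) (map_mono hNM) ?_ ih
    rw [← MonoidHom.map_zpowers, ← Subgroup.map_sup]
    exact map_mono hM

theorem comap {T' : Type u} [Group T'] {f : T →* T'} (hf : Function.Surjective f)
    {N : Subgroup T'} (h : SupersolvableOver N) : SupersolvableOver (N.comap f) := by
  induction h with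
  | top => rw [comap_top]; exact top
  | step N M b hN hNM hM _ ih =>
    obtain ⟨b, rfl⟩ := hf b
    refine step _ _ b inferInstance (comap_mono hNM) ?_ ih
    refine (comap_mono hM).trans ?_
    intro x hx
    obtain ⟨y, hy, n, hn, hyn⟩ := mem_sup_of_normal_right.1 (mem_comap.1 hx)
    obtain ⟨k, rfl⟩ := mem_zpowers_iff.1 hy
    have : (b ^ k)⁻¹ * x ∈ N.comap f := by
      rw [mem_comap, map_mul, ← hyn, map_inv, map_zpow, inv_mul_cancel_left]
      exact hn
    have h3 := mul_mem_sup (zpow_mem (mem_zpowers b) k) this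
    rwa [mul_inv_cancel_left] at h3

theorem iff_quotient [hN : N.Normal] : SupersolvableOver N ↔ IsSupersolvable (T ⧸ N) := by
  have hs := QuotientGroup.mk'_surjective N
  constructor
  · intro h
    refine isSupersolvable ?_
    have := h.map hs
    rwa [QuotientGroup.map_mk'_self] at this
  · intro h
    have := (of_isSupersolvable h).comap hs
    rwa [MonoidHom.comap_bot, QuotientGroup.ker_mk'] at this

theorem psupersolvableOver [Finite T] (h : SupersolvableOver N) (p : ℕ) (hp : p.Prime) :
    PSupersolvableOver p N := by
  induction h with
  | top => exact PSupersolvableOver.top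
  | step N M b hN hNM hM h ih =>
    refine ih.trans h.normal hNM fun K L hKL hK hL ↦ ?_
    have hKn := hKL.1
    have hc : IsCyclic (L.map (QuotientGroup.mk' K)) :=
      isCyclic_map_mk'_iff.2 ⟨b, hL.trans (hM.trans (sup_le_sup_left hK _))⟩
    have := hKL.map_mk'.prime_of_isCyclic
    rw [card_map_mk'] at this
    by_cases hd : p ∣ K.relIndex L
    · exact Or.inr ((Nat.prime_dvd_prime_iff_eq hp this).1 hd).symm
    · exact Or.inl hd

/-- By solvability a chief factor has order q^k with k ≠ 0, and the hypothesis at q forces order q,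
hence cyclicity. -/
theorem of_forall_psupersolvableOver [Finite T] [Group.IsSolvable T] :
    ∀ N : Subgroup T, N.Normal → (∀ p, p.Prime → PSupersolvableOver p N) → SupersolvableOver N := by
  intro N
  induction N using WellFoundedGT.induction with
  | ind N ih =>
    intro hN h
    by_cases hT : N = ⊤
    · subst hT; exact top
    obtain ⟨M, -, hM⟩ := exists_isChiefFactor hN inferInstance (lt_top_iff_ne_top.2 hT)
    obtain ⟨q, k, hq, hk, e⟩ := hM.relIndex_eq_prime_pow
    have e' := (h q hq N M hM le_rfl).resolve_left (not_not.2 (e ▸ dvd_pow_self q hk))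
    have hc : IsCyclic (M.map (QuotientGroup.mk' N)) := by
      have := Fact.mk hq
      exact isCyclic_of_prime_card (card_map_mk'.trans e')
    obtain ⟨b, hb⟩ := isCyclic_map_mk'_iff.1 hc
    exact step N M b hN hM.2.2.1.le hb
      (ih M hM.2.2.1 hM.2.1 fun p hp ↦ (h p hp).mono hM.2.2.1.le)

end SupersolvableOver

section Residual

variable {T : Type u} [Group T] {p : ℕ}

theorem groupResidual_le_of_supersolvableOver {N : Subgroup T} (h : SupersolvableOver N) :
    groupResidual supersolvableClass T ≤ N :=
  have := h.normal
  sInf_le ⟨this, SupersolvableOver.iff_quotient.1 h⟩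

theorem groupResidual_pSupersolvableClass_le [Finite T] (hp : p.Prime) :
    groupResidual (pSupersolvableClass p) T ≤ groupResidual supersolvableClass T :=
  le_sInf fun _ ⟨hN, h⟩ ↦ groupResidual_le_of_psupersolvableOver hp hN
    ((SupersolvableOver.iff_quotient.2 h).psupersolvableOver p hp)

/-- The supersolvable residual of a solvable group is generated by its `p`-supersolvable residuals,
where `p` runs over any set of primes containing those that divide the order of the group. -/
theorem groupResidual_supersolvableClass_eq_iSup [Finite T] [Group.IsSolvable T] (s : Finset ℕ)
    (hs : ∀ p ∈ s, p.Prime) (hT : ∀ p, p.Prime → p ∣ Nat.card T → p ∈ s) :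
    groupResidual supersolvableClass T = ⨆ p ∈ s, groupResidual (pSupersolvableClass p) T := by
  refine le_antisymm ?_ (iSup₂_le fun p hp ↦ groupResidual_pSupersolvableClass_le (hs p hp))
  have hn (p : ℕ) := groupResidual_normal (T := T) (pSupersolvableClass p)
  refine groupResidual_le_of_supersolvableOver
    (SupersolvableOver.of_forall_psupersolvableOver _ inferInstance fun p hp ↦ ?_)
  by_cases h : p ∈ s
  · exact (psupersolvableOver_groupResidual hp).mono
      (le_iSup₂ (f := fun p (_ : p ∈ s) ↦ groupResidual (pSupersolvableClass p) T) p h)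
  · exact fun K L _ _ ↦ Or.inl fun hd ↦ h (hT p hp
      (hd.trans ((relIndex_dvd_card K L).trans (card_subgroup_dvd_card L))))

end Residual

/-! ### Normal complements and centralizers of a subgroup of order p -/

section Complement

variable {X : Type u} [Group X] {p : ℕ}

open scoped IsMulCommutative in
/-- A central normal Sylow `p`-subgroup `R` of order `p` of a normal subgroup `C` has a complement
in `C` that is normal in the whole group. -/
theorem exists_normal_complement_of_central [Finite X] (hp : p.Prime) {R C : Subgroup X} (hC : C.Normal)
    (hRC : R ≤ C) (hR : Nat.card R = p) (hcomm : C ≤ centralizer (R : Set X))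
    (hind : ¬ p ∣ R.relIndex C) :
    ∃ Q : Subgroup X, Q.Normal ∧ Q ≤ C ∧ ¬ p ∣ Nat.card Q ∧ C ≤ R ⊔ Q := by
  set m := R.relIndex C with hm
  have hcent : R.subgroupOf C ≤ center C := by
    intro r hr
    rw [mem_center_iff]
    intro c
    exact Subtype.ext (mem_centralizer_iff.1 (hcomm c.2) _ (mem_subgroupOf.1 hr)).symm
  have key (x : C) (k : ℕ) (y : C) (h : y⁻¹ * x ^ k * y ∈ R.subgroupOf C) :
      y⁻¹ * x ^ k * y = x ^ k := by
    have := mem_center_iff.1 (hcent h) y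
    rw [← mul_left_inj y, ← this]
    group
  -- As R is central, the transfer is x ↦ x^m. Its kernel, the solutions of x^m = 1 in C, is
  -- therefore visibly invariant under conjugation in X.
  let f : C →* center C := MonoidHom.transfer (inclusion hcent)
  have hf (x : C) : ((f x : C) : X) = (x : X) ^ m := by
    have := MonoidHom.transfer_eq_pow (inclusion hcent) x (key x)
    exact congrArg (fun z : center C ↦ ((z : C) : X)) this
  have hQ (x : X) : x ∈ f.ker.map C.subtype ↔ x ∈ C ∧ x ^ m = 1 := by
    constructor
    · rintro ⟨y, hy, rfl⟩
      refine ⟨y.2, ?_⟩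
      rw [coe_subtype, ← hf, MonoidHom.mem_ker.1 hy]
      rfl
    · rintro ⟨hx, hxm⟩
      refine ⟨⟨x, hx⟩, MonoidHom.mem_ker.2 (Subtype.ext (Subtype.ext ?_)), rfl⟩
      rw [hf]
      exact hxm
  have := Fact.mk hp
  refine ⟨f.ker.map C.subtype, ⟨fun x hx g ↦ ?_⟩, map_subtype_le _, fun hd ↦ ?_, fun x hx ↦ ?_⟩
  · rw [hQ] at hx ⊢
    exact ⟨hC.conj_mem x hx.1 g, by rw [conj_pow, hx.2, mul_one, mul_inv_cancel]⟩
  · obtain ⟨z, hz⟩ := exists_prime_orderOf_dvd_card' p hd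
    rw [← orderOf_coe] at hz
    exact hind (hz ▸ orderOf_dvd_of_pow_eq_one ((hQ z).1 z.2).2)
  · have hxm : x ^ m ∈ R := MonoidHom.transfer_eq_pow_aux (⟨x, hx⟩ : C) (key ⟨x, hx⟩)
    have hxp : (x ^ m) ^ p = 1 := by
      rw [← hR]
      exact congrArg Subtype.val (pow_card_eq_one' (x := (⟨x ^ m, hxm⟩ : R)))
    -- With m·a ≡ 1 mod p, the power x^(m·a) is the R-part of x, and the remaining factor is killed
    -- by m.
    obtain ⟨a, -, ha⟩ := Nat.exists_mul_mod_eq_one_of_coprime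
      ((Nat.Prime.coprime_iff_not_dvd hp).2 hind).symm hp.one_lt
    have hpow : (x ^ m) ^ (m * a) = x ^ m := by
      rw [← Nat.mod_add_div (m * a) p, ha, pow_add, pow_mul, hxp, one_pow, pow_one, mul_one]
    have h1 : (x ^ m) ^ a ∈ R := pow_mem hxm a
    have h2 : ((x ^ m) ^ a)⁻¹ * x ∈ f.ker.map C.subtype := by
      rw [hQ]
      refine ⟨mul_mem (inv_mem (hRC h1)) hx, ?_⟩
      have hc : Commute ((x ^ m) ^ a)⁻¹ x := (((Commute.refl x).pow_left m).pow_left a).inv_left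
      rw [hc.mul_pow, inv_pow, ← pow_mul, mul_comm a, hpow, inv_mul_cancel]
    have h3 := mul_mem_sup h1 h2
    rwa [mul_inv_cancel_left] at h3

/-- W modulo the centralizer of R embeds in Aut R, which is cyclic because |R| = p. -/
theorem exists_le_zpowers_sup_centralizer {R W : Subgroup X} [R.Normal] (hp : p.Prime)
    (hR : Nat.card R = p) : ∃ b, W ≤ zpowers b ⊔ (W ⊓ centralizer (R : Set X)) := by
  have := Fact.mk hp
  have : IsCyclic R := isCyclic_of_prime_card hR
  let e := IsCyclic.mulAutMulEquiv R
  have : IsCyclic (MulAut R) := by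
    rw [hR] at e
    exact isCyclic_of_injective e.toMonoidHom e.injective
  obtain ⟨⟨⟨_, b, hb, rfl⟩, hg⟩⟩ := (inferInstance :
    IsCyclic (W.map (MulAut.conjNormal : X →* MulAut R)))
  refine ⟨b, fun x hx ↦ ?_⟩
  obtain ⟨k, hk⟩ := hg ⟨_, mem_map_of_mem _ hx⟩
  have hk' : MulAut.conjNormal (b ^ k) = (MulAut.conjNormal x : MulAut R) := by
    simpa using congrArg Subtype.val hk
  have h1 : (b ^ k)⁻¹ * x ∈ W ⊓ centralizer (R : Set X) := by
    refine ⟨W.mul_mem (W.inv_mem (W.zpow_mem hb k)) hx, mem_centralizer_iff.2 fun r hr ↦ ?_⟩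
    have h2 : MulAut.conjNormal ((b ^ k)⁻¹ * x) = (1 : MulAut R) := by
      rw [map_mul, ← hk', ← map_mul, inv_mul_cancel, map_one]
    have h3 := congrArg Subtype.val (DFunLike.congr_fun h2 (⟨r, hr⟩ : R))
    rw [MulAut.conjNormal_apply, MulAut.one_apply] at h3
    exact (mul_inv_eq_iff_eq_mul.1 h3).symm
  have h3 := mul_mem_sup (zpow_mem (mem_zpowers b) k) h1
  rwa [mul_inv_cancel_left] at h3

end Complement

/-! ### Solvable p-supersolvable groups are p'-by-supersolvable -/

section PPrimeByPSupersolvable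

/-- A solvable `p`-supersolvable group is an extension of a `p'`-group by a supersolvable group. -/
theorem IsPSupersolvable.exists_supersolvableOver {p : ℕ} (hp : p.Prime) (n : ℕ) :
    ∀ (X : Type u) [Group X] [Finite X] [Group.IsSolvable X], Nat.card X = n →
      IsPSupersolvable p X → ∃ W : Subgroup X, ¬ p ∣ Nat.card W ∧ SupersolvableOver W := by
  induction n using Nat.strong_induction_on with
  | _ n ih =>
    intro X _ _ _ hn h
    by_cases hX : (⊥ : Subgroup X) = ⊤
    · refine ⟨⊥, ?_, hX ▸ SupersolvableOver.top⟩
      rw [card_bot]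
      exact fun hd ↦ hp.one_lt.ne' (Nat.dvd_one.1 hd)
    obtain ⟨R, -, hR⟩ := exists_isChiefFactor (T := X) (K := ⊥) inferInstance inferInstance
      (lt_top_iff_ne_top.2 hX)
    have hRn := hR.2.1
    have hRbot : R ≠ ⊥ := hR.2.2.1.ne'
    have hs := QuotientGroup.mk'_surjective R
    have hlt : Nat.card (X ⧸ R) < n := by
      rw [← hn, card_eq_card_quotient_mul_card_subgroup R]
      exact lt_mul_of_one_lt_right Nat.card_pos (R.one_lt_card_iff_ne_bot.2 hRbot)
    obtain ⟨W', hW', hSW'⟩ := ih _ hlt (X ⧸ R) rfl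
      ((PSupersolvableOver.iff_quotient hp).1 (PSupersolvableOver.of_isPSupersolvable h))
    have hSW := hSW'.comap hs
    set W := W'.comap (QuotientGroup.mk' R) with hWdef
    have hWn := hSW.normal
    have hRW : R ≤ W := by
      conv_lhs => rw [← QuotientGroup.ker_mk' R, ← MonoidHom.comap_bot]
      exact comap_mono bot_le
    have hRWi : R.relIndex W = Nat.card W' := by
      rw [← card_map_mk', map_comap_eq_self_of_surjective hs]
    have hRc := h ⊥ R hR
    rw [relIndex_bot_left] at hRc
    rcases hRc with hRc | hRc
    · refine ⟨W, ?_, hSW⟩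
      rw [← relIndex_bot_left, ← relIndex_mul_relIndex ⊥ R W bot_le hRW, hRWi, relIndex_bot_left,
        hp.dvd_mul]
      exact not_or.2 ⟨hRc, hW'⟩
    -- Here |R| = p and W/R is a p'-group, so R is a central Sylow subgroup of C with normal
    -- complement Q. In the chain Q ≤ C ≤ W, the factor C/Q is covered by R and W/C embeds in Aut R,
    -- so both are cyclic.
    · set C := W ⊓ centralizer (R : Set X) with hCdef
      have := Fact.mk hp
      have hRcyc : IsCyclic R := isCyclic_of_prime_card hRc
      have hRR : R ≤ centralizer (R : Set X) := by
        have := hRcyc.isMulCommutative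
        exact le_centralizer R
      have hCn : C.Normal := inferInstance
      have hRC : R ≤ C := le_inf hRW hRR
      obtain ⟨Q, hQn, hQC, hQp, hQ⟩ := exists_normal_complement_of_central hp hCn hRC hRc
        inf_le_right fun hd ↦ hW' (hRWi ▸ hd.trans
          (PSupersolvableOver.relIndex_dvd_of_between le_rfl hRC inf_le_left))
      obtain ⟨b, hb⟩ := exists_le_zpowers_sup_centralizer (W := W) hp hRc
      obtain ⟨r, hr⟩ := (Subgroup.isCyclic_iff_exists_zpowers_eq_top R).1 hRcyc
      refine ⟨Q, hQp, .step Q C r hQn hQC ?_ (.step C W b hCn inf_le_left hb hSW)⟩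
      rwa [hr]

variable {T : Type u} [Group T] [Finite T] [Group.IsSolvable T] {p : ℕ}

/-- If the `p`-supersolvable residual is a `p`-group, then it consists of the `p`-elements of the
supersolvable residual. -/
theorem mem_groupResidual_iff_of_isPGroup (hp : p.Prime)
    (h : IsPGroup p (groupResidual (pSupersolvableClass p) T)) {x : T} :
    x ∈ groupResidual (pSupersolvableClass p) T ↔
      x ∈ groupResidual supersolvableClass T ∧ ∃ k, x ^ p ^ k = 1 := by
  constructor
  · intro hx
    obtain ⟨k, hk⟩ := h ⟨x, hx⟩
    exact ⟨groupResidual_pSupersolvableClass_le hp hx, k, congrArg Subtype.val hk⟩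
  · rintro ⟨hx, k, hk⟩
    have hL := groupResidual_normal (T := T) (pSupersolvableClass p)
    set L := groupResidual (pSupersolvableClass p) T
    obtain ⟨W, hW, hSW⟩ := IsPSupersolvable.exists_supersolvableOver hp _ (T ⧸ L) rfl
      ((PSupersolvableOver.iff_quotient hp).1 (psupersolvableOver_groupResidual hp))
    have hxW : QuotientGroup.mk' L x ∈ W := groupResidual_le_of_supersolvableOver
      (hSW.comap (QuotientGroup.mk'_surjective L)) hx
    have h1 : orderOf (QuotientGroup.mk' L x) ∣ p ^ k :=
      orderOf_dvd_of_pow_eq_one (by rw [← map_pow, hk, map_one])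
    have h2 : orderOf (QuotientGroup.mk' L x) ∣ Nat.card W := by
      rw [← orderOf_mk _ hxW]
      exact orderOf_dvd_natCard _
    have h3 : (p ^ k).Coprime (Nat.card W) := ((Nat.Prime.coprime_iff_not_dvd hp).2 hW).pow_left k
    have h4 := Nat.eq_one_of_dvd_coprimes h3 h1 h2
    rw [orderOf_eq_one_iff] at h4
    exact (QuotientGroup.eq_one_iff x).1 h4

end PPrimeByPSupersolvable

/-! ### Groups whose maximal subgroups are p-supersolvable modulo K -/

section MinimalCase

variable {T : Type u} [Group T] [Finite T] {p : ℕ}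

/-- A normal subgroup containing the residual and lying over the Frattini subgroup with `p`-power
index has a normal Sylow `p`-subgroup, and the residual is contained in it. -/
theorem isPGroup_groupResidual_of_le (hp : p.Prime) {V : Subgroup T} (hV : V.Normal)
    (hle : groupResidual (pSupersolvableClass p) T ≤ V) (hF : frattini T ≤ V) {k : ℕ}
    (hk : (frattini T).relIndex V = p ^ k) :
    IsPGroup p (groupResidual (pSupersolvableClass p) T) := by
  have := Fact.mk hp
  let P : Sylow p V := default
  set P' := (P : Subgroup V).map V.subtype with hP'
  have hP'V : P' ≤ V := map_subtype_le _
  have hind : ¬ p ∣ P'.relIndex V := by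
    rw [relIndex, subgroupOf, hP', comap_map_eq_self_of_injective V.subtype_injective]
    exact P.not_dvd_index
  have hsup : P' ⊔ frattini T = V := by
    refine le_antisymm (sup_le hP'V hF) (relIndex_eq_one.1 ?_)
    have h1 := PSupersolvableOver.relIndex_dvd_of_between (N := frattini T) (M := V)
      (le_sup_right (a := P')) (sup_le hP'V hF) le_rfl
    have h2 := PSupersolvableOver.relIndex_dvd_of_between (N := P') (M := V)
      (le_sup_left (b := frattini T)) (sup_le hP'V hF) le_rfl
    rw [hk] at h1
    exact Nat.eq_one_of_dvd_coprimes (((Nat.Prime.coprime_iff_not_dvd hp).2 hind).pow_left k) h1 h2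
  -- Frattini's argument: T = N(P')V and V = P'Φ(T), so N(P')Φ(T) = T; the Frattini subgroup can be
  -- dropped.
  have hnorm : normalizer (P' : Set T) = ⊤ := by
    refine frattini_nongenerating ?_
    have h1 := P.normalizer_sup_eq_top
    rw [eq_top_iff, ← h1]
    refine sup_le le_sup_left ?_
    rw [← hsup]
    exact sup_le (le_normalizer.trans le_sup_left) le_sup_right
  have hP'n : P'.Normal := normalizer_eq_top_iff.1 hnorm
  have hover : PSupersolvableOver p P' := PSupersolvableOver.trans_of_relIndex hp hV
    ((psupersolvableOver_groupResidual hp).mono hle) hP'V (Or.inl hind)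
  exact (P.2.map V.subtype).to_le (groupResidual_le_of_psupersolvableOver hp hP'n hover)

/-- If a maximal Y misses K, then T = YK and T/K is a quotient of Y. Otherwise K ≤ Φ(T), and a
maximal subgroup missing a chief factor R/Φ(T) shows in the same way that T/R is p-supersolvable. -/
theorem groupResidual_le_or_isPGroup [Group.IsSolvable T] (hp : p.Prime) {K : Subgroup T} (hK : K.Normal)
    (h : ∀ Y : Subgroup T, IsCoatom Y → PSupersolvableOver p (K.subgroupOf Y)) :
    groupResidual (pSupersolvableClass p) T ≤ K ∨
      IsPGroup p (groupResidual (pSupersolvableClass p) T) := by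
  by_cases hY : ∃ Y : Subgroup T, IsCoatom Y ∧ ¬ K ≤ Y
  · obtain ⟨Y, hY, hKY⟩ := hY
    left
    exact groupResidual_le_of_psupersolvableOver hp hK
      (PSupersolvableOver.of_subgroup_sup_eq_top hp hK
        (hY.2 _ (left_lt_sup.2 hKY)) (h Y hY))
  right
  push Not at hY
  have hKF : K ≤ frattini T := le_iInf₂ fun Y hY' ↦ hY Y hY'
  by_cases hF : frattini T = ⊤
  · refine isPGroup_groupResidual_of_le hp (V := ⊤) (k := 0) inferInstance le_top le_top ?_
    rw [hF, relIndex_self, pow_zero]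
  obtain ⟨R, -, hR⟩ := exists_isChiefFactor (K := frattini T) inferInstance inferInstance
    (lt_top_iff_ne_top.2 hF)
  have hRn := hR.2.1
  have hover : PSupersolvableOver p R := by
    have : ∃ Y : Subgroup T, IsCoatom Y ∧ ¬ R ≤ Y := by
      by_contra! hc
      exact hR.2.2.1.not_ge (le_iInf₂ fun Y hY' ↦ hc Y hY')
    obtain ⟨Y, hY, hRY⟩ := this
    exact PSupersolvableOver.of_subgroup_sup_eq_top hp hRn (hY.2 _ (left_lt_sup.2 hRY))
      ((h Y hY).mono (comap_mono (hKF.trans hR.2.2.1.le)))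
  obtain ⟨q, k, hq, hk, hqk⟩ := hR.relIndex_eq_prime_pow
  by_cases hqp : q = p
  · subst hqp
    exact isPGroup_groupResidual_of_le hp hRn (groupResidual_le_of_psupersolvableOver hp hRn hover)
      hR.2.2.1.le hqk
  -- For q ≠ p the factor R/Φ(T) is a p'-group, so T/Φ(T) is already p-supersolvable and V = Φ(T)
  -- has index p^0 over itself.
  · refine isPGroup_groupResidual_of_le hp (V := frattini T) (k := 0) inferInstance ?_ le_rfl ?_
    · refine groupResidual_le_of_psupersolvableOver hp inferInstance
        (PSupersolvableOver.trans_of_relIndex hp hRn hover hR.2.2.1.le (Or.inl ?_))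
      rw [hqk]
      exact fun hd ↦ hqp ((Nat.prime_dvd_prime_iff_eq hp hq).1 (hp.dvd_of_dvd_pow hd)).symm
    · rw [relIndex_self, pow_zero]

end MinimalCase

/-! ### Comparison of the weak norms -/

section WeakNorm

variable {G : Type u} [Group G]

theorem Subgroup.mem_normalizer_iSup {ι : Sort*} {K : ι → Subgroup G} {g : G}
    (h : ∀ i, g ∈ normalizer (K i : Set G)) : g ∈ normalizer ((⨆ i, K i : Subgroup G) : Set G) := by
  rw [mem_normalizer_iff_map_conj_eq, Subgroup.map_iSup]
  exact iSup_congr fun i ↦ mem_normalizer_iff_map_conj_eq.1 (h i)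

theorem mem_weakNorm {F : GroupClass.{u}} {H : Subgroup G} {g : G} :
    g ∈ weakNorm F H ↔ ∀ T ≤ H, g ∈ normalizer (subgroupResidual F T : Set G) := by
  simp only [weakNorm, mem_iInf]

variable [Finite G] {p : ℕ}

/-- An endomorphism f covers both uses: the identity gives monotonicity, an inner automorphism gives
conjugation invariance. -/
theorem map_subgroupResidual_le (hp : p.Prime) (f : G →* G) {S T : Subgroup G} (h : S.map f ≤ T) :
    (subgroupResidual (pSupersolvableClass p) S).map f ≤
      subgroupResidual (pSupersolvableClass p) T := by
  rintro _ ⟨_, ⟨x, hx, rfl⟩, rfl⟩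
  let f' : S →* T := (f.comp S.subtype).codRestrict T fun s ↦ h (mem_map_of_mem f s.2)
  exact ⟨f' x, map_groupResidual_le hp f' (mem_map_of_mem f' hx), rfl⟩

theorem subgroupResidual_mono (hp : p.Prime) {S T : Subgroup G} (h : S ≤ T) :
    subgroupResidual (pSupersolvableClass p) S ≤ subgroupResidual (pSupersolvableClass p) T := by
  have := map_subgroupResidual_le hp (MonoidHom.id G) (S := S) (T := T) (by rwa [Subgroup.map_id])
  rwa [Subgroup.map_id] at this

theorem weakNorm_supersolvableClass_le [Group.IsSolvable G] (hp : p.Prime) (H : Subgroup G) :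
    weakNorm supersolvableClass H ≤ weakNorm (pSupersolvableClass p) H := by
  intro g hg
  rw [mem_weakNorm] at hg ⊢
  intro T
  induction T using WellFoundedLT.induction with
  | ind T ih =>
    intro hTH
    let K : Subgroup G := ⨆ S : {S : Subgroup G // S < T}, subgroupResidual (pSupersolvableClass p) S.1
    have hSK (S : Subgroup G) (hS : S < T) : subgroupResidual (pSupersolvableClass p) S ≤ K :=
      le_iSup (fun S : {S : Subgroup G // S < T} ↦
        subgroupResidual (pSupersolvableClass p) S.1) ⟨S, hS⟩
    have hKL : K ≤ subgroupResidual (pSupersolvableClass p) T :=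
      iSup_le fun S ↦ subgroupResidual_mono hp S.2.le
    have hKg : g ∈ normalizer (K : Set G) :=
      mem_normalizer_iSup fun S ↦ ih S.1 S.2 (S.2.le.trans hTH)
    -- Conjugation by an element of T sends proper subgroups of T to proper subgroups of T, hence
    -- preserves the join K.
    have hKn : (K.subgroupOf T).Normal := by
      refine ⟨fun x hx t ↦ ?_⟩
      have h1 : K.map (MulAut.conj (t : G)).toMonoidHom ≤ K := by
        rw [Subgroup.map_iSup]
        refine iSup_le fun S ↦ ?_
        have hT : T.map (MulAut.conj (t : G)).toMonoidHom = T :=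
          mem_normalizer_iff_map_conj_eq.1 (le_normalizer t.2)
        have h2 : S.1.map (MulAut.conj (t : G)).toMonoidHom < T := by
          have h3 := (map_lt_map_iff_of_injective
            (f := (MulAut.conj (t : G)).toMonoidHom) (MulAut.conj (t : G)).injective).2 S.2
          exact h3.trans_eq hT
        exact (map_subgroupResidual_le hp _ le_rfl).trans (hSK _ h2)
      exact h1 (mem_map_of_mem _ (mem_subgroupOf.1 hx))
    have hKY (Y : Subgroup T) (hY : IsCoatom Y) :
        PSupersolvableOver p ((K.subgroupOf T).subgroupOf Y) := by
      refine (psupersolvableOver_groupResidual hp).mono fun x hx ↦ ?_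
      have hlt : Y.map T.subtype < T := by
        refine lt_of_le_of_ne (map_subtype_le Y) fun e ↦ hY.1 ?_
        rw [← map_subtype_inj (H := T), e, ← MonoidHom.range_eq_map, range_subtype]
      refine hSK _ hlt ⟨T.subtype.subgroupMap Y x, ?_, rfl⟩
      exact map_groupResidual_le hp (T.subtype.subgroupMap Y) (mem_map_of_mem _ hx)
    rcases groupResidual_le_or_isPGroup hp hKn hKY with h | h
    · have : subgroupResidual (pSupersolvableClass p) T = K :=
        le_antisymm (map_le_iff_le_comap.2 h) hKL
      rwa [this]
    · have hmem (x : G) : x ∈ subgroupResidual (pSupersolvableClass p) T ↔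
          x ∈ subgroupResidual supersolvableClass T ∧ ∃ k, x ^ p ^ k = 1 := by
        constructor
        · rintro ⟨y, hy, rfl⟩
          obtain ⟨h1, k, h2⟩ := (mem_groupResidual_iff_of_isPGroup hp h).1 hy
          exact ⟨⟨y, h1, rfl⟩, k, congrArg Subtype.val h2⟩
        · rintro ⟨⟨y, hy, rfl⟩, k, hk⟩
          exact ⟨y, (mem_groupResidual_iff_of_isPGroup hp h).2 ⟨hy, k, Subtype.ext hk⟩, rfl⟩
      rw [mem_normalizer_iff]
      intro x
      rw [hmem, hmem, ← mem_normalizer_iff.1 (hg T hTH) x]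
      simp only [conj_pow, conj_eq_one_iff]

/-- In a solvable group the weak norm for the supersolvable class is the intersection of the weak
norms for the `p`-supersolvable classes. -/
theorem iInf_weakNorm_eq [Group.IsSolvable G] (H : Subgroup G) :
    (⨅ p ∈ (Nat.card H).primeFactors, weakNorm (pSupersolvableClass p) H) =
      weakNorm supersolvableClass H := by
  refine le_antisymm (fun g hg ↦ ?_)
    (le_iInf₂ fun p hp ↦ weakNorm_supersolvableClass_le (Nat.prime_of_mem_primeFactors hp) H)
  simp only [mem_iInf, mem_weakNorm] at hg
  rw [mem_weakNorm]
  intro T hT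
  -- The primes of |T| are among those of |H|, so the index set need not depend on T.
  have h : subgroupResidual supersolvableClass T =
      ⨆ p : {p // p ∈ (Nat.card H).primeFactors}, subgroupResidual (pSupersolvableClass p.1) T := by
    rw [subgroupResidual, groupResidual_supersolvableClass_eq_iSup (Nat.card H).primeFactors
      (fun p hp ↦ Nat.prime_of_mem_primeFactors hp)
      (fun p hp hd ↦ Nat.mem_primeFactors.2 ⟨hp, hd.trans (card_dvd_of_le hT), Nat.card_pos.ne'⟩),
      iSup_subtype', Subgroup.map_iSup]
    rfl
  rw [h]
  exact mem_normalizer_iSup fun p ↦ hg p.1 p.2 T hT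

end WeakNorm

theorem theorem3p14 {G : Type u} [Group G] [Finite G] (hG : Group.IsSolvable G)
    (H : Subgroup G) (hH : H.Normal) :
    (⨅ p ∈ (Nat.card H).primeFactors, weakNorm (pSupersolvableClass p) H) = ⊥ ↔
      weakNorm supersolvableClass H = ⊥ := by
  rw [iInf_weakNorm_eq]
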